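/- Let $m\ge 2$ and let $G=\mathbb Z/m*\mathbb Z/m=\langle a,b\mid a^m=b^m=1\rangle$. Let $\varphi$ be the automorphism of $G$ with $\varphi(a)=b$, $\varphi(b)=a$; it generates a group $H=\langle\varphi\rangle$ of order $2$. Let $X=G/H$ be the set of $H$-orbits in $G$, let $\pi:G\to X$ be the quotient map, and let $X$ carry the coset group structure, that is, the $2$-valued multiplication $\pi(u)*\pi(v)=[\pi(u\,h(v)) \mid h\in H]$ (a multiset of two points) with unit $e=\pi(1)$. Put $g=\pi(a)=[a,b]$. For $k\ge 0$ let $g^k$ be the multiset obtained from $e$ by applying the left multiplication by $g$ $k$ times (so $g^0=[e]$), and let the growth function $\xi_k$ be the number of different points in $g^0\cup g^1\cup\dots\cup g^k$. A word in the letters $a,b$ is in normal form if no letter occurs $m$ times in a row. Let $S_k$ be the number of distinct words of length $k$ in $g^k$, that is, the number of different points of $g^k$ that are represented by a normal form word of length $k$. For $n\ge 1$ the $n$-bonacci sequence $(F^{(n)}_j)_{j\ge0}$ is defined by $F^{(n)}_0=\dots=F^{(n)}_{n-2}=0$, $F^{(n)}_{n-1}=1$ and $F^{(n)}_j=F^{(n)}_{j-1}+\dots+F^{(n)}_{j-n}$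 for $j\ge n$. 1. Suppose $m\ge 3$. The polynomial $\chi(\lambda)=\lambda^{m-1}-\lambda^{m-2}-\dots-\lambda-1$ has exactly one positive real root $r$; moreover $r>1$, $mr-2(m-1)>0$, and $$\xi_k\sim\frac{r^{k+1}}{mr-2(m-1)}\qquad(k\to\infty).$$ 2. Suppose $m\ge 3$. Then $S_k=F^{(m-1)}_{k+m-2}$ for all $k\ge 0$. 3. For $m\ge2$, the growth is polynomial (that is, $\xi_k=O(k^d)$ for some $d\in\mathbb N$) if and only if $m=2$. -/

import Mathlib

open Filter Asymptotics

/-- An `n`-valued group structure on `X`: an `n`-valued multiplication with values in the `n`-th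
symmetric power, associative (as an equality of multisets with `n ^ 2` entries), with a unit and
inverses. -/
structure NValuedGroup (n : ℕ) (X : Type*) where
  mul : X → X → Sym X n
  one : X
  inv : X → X
  mul_assoc : ∀ x y z : X,
    (mul y z : Multiset X).bind (fun t => (mul x t : Multiset X)) =
      (mul x y : Multiset X).bind (fun t => (mul t z : Multiset X))
  one_mul : ∀ x, mul one x = Sym.replicate n x
  mul_one : ∀ x, mul x one = Sym.replicate n x
  one_mem_inv_mul : ∀ x, one ∈ mul (inv x) x
  one_mem_mul_inv : ∀ x, one ∈ mul x (inv x)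

/-- The multiset `T ^ k (x)` of states reached from `x` in `k` steps of an `n`-valued dynamics
`T : X → Sym X n`. -/
def dynamicsIter {n : ℕ} {X : Type*} (T : X → Sym X n) (x : X) : ℕ → Multiset X
  | 0 => {x}
  | k + 1 => (dynamicsIter T x k).bind (fun y => (T y : Multiset X))

/-- The growth function of an `n`-valued dynamics `T` with marked starting point `x`: the number of
different points in `{x} ∪ T (x) ∪ ... ∪ T ^ k (x)`. -/
noncomputable def dynamicsGrowth {n : ℕ} {X : Type*} (T : X → Sym X n) (x : X) (k : ℕ) : ℕ :=
  Set.ncard {y : X | ∃ i ≤ k, y ∈ dynamicsIter T x i}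

namespace NValuedGroup

variable {n : ℕ} {X : Type*}

/-- The multiset of values of the power `g ^ k`: the left multiplication by `g`, applied `k` times
to the unit. -/
def pow (A : NValuedGroup n X) (g : X) (k : ℕ) : Multiset X :=
  dynamicsIter (A.mul g) A.one k

/-- The growth function of an `n`-valued group with respect to an element `g`: the growth function
of the left multiplication by `g`, the marked point being the unit. Its value at `k` is the number
of different points in `{1} ∪ g ∪ g ^ 2 ∪ ... ∪ g ^ k`. -/
noncomputable def growth (A : NValuedGroup n X) (g : X) (k : ℕ) : ℕ :=
  dynamicsGrowth (A.mul g) A.one k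

end NValuedGroup

section Coset

variable {G : Type*} [Group G] (H : Subgroup (MulAut G))

/-- The quotient map from `G` to the set of orbits of a group `H` of automorphisms of `G`. -/
def cosetProj (u : G) : MulAction.orbitRel.Quotient H G := Quotient.mk _ u

theorem cosetProj_smul (h : H) (u : G) : cosetProj H (h • u) = cosetProj H u :=
  Quotient.sound ⟨h, rfl⟩

variable [Finite H]

/-- The multiset `[π (u * h v) | h ∈ H]`, for elements `u`, `v` of `G`. -/
noncomputable def cosetMulAux (u v : G) : Sym (MulAction.orbitRel.Quotient H G) (Nat.card H) :=
  letI := Fintype.ofFinite H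
  ⟨(Finset.univ : Finset H).val.map (fun h => cosetProj H (u * h • v)), by
    rw [Multiset.card_map, Finset.card_val, Finset.card_univ, Nat.card_eq_fintype_card]⟩

theorem cosetMulAux_congr (u v u' v' : G) (hu : MulAction.orbitRel H G u u')
    (hv : MulAction.orbitRel H G v v') : cosetMulAux H u v = cosetMulAux H u' v' := by
  let _ := Fintype.ofFinite H
  obtain ⟨k, rfl⟩ := hu
  obtain ⟨l, rfl⟩ := hv
  apply Subtype.ext
  change (Finset.univ : Finset H).val.map _ = (Finset.univ : Finset H).val.map _
  let e : H ≃ H := (Equiv.mulLeft k⁻¹).trans (Equiv.mulRight l)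
  conv_rhs => rw [← Multiset.map_univ_val_equiv e, Multiset.map_map]
  refine Multiset.map_congr rfl fun h _ => ?_
  change cosetProj H (k • u' * h • l • v') = cosetProj H (u' * (k⁻¹ * h * l) • v')
  rw [← cosetProj_smul H k (u' * _), smul_mul', ← mul_smul, ← mul_smul]
  congr 3
  group

/-- The multiplication of the coset group: `x * y = [π (u * h v) | h ∈ H]`, where `π u = x` and
`π v = y`. -/
noncomputable def cosetMul (x y : MulAction.orbitRel.Quotient H G) :
    Sym (MulAction.orbitRel.Quotient H G) (Nat.card H) :=
  Quotient.lift₂ (cosetMulAux H) (fun u v u' v' => cosetMulAux_congr H u v u' v') x y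

theorem coe_cosetMul [Fintype H] (u v : G) :
    (cosetMul H (cosetProj H u) (cosetProj H v) : Multiset (MulAction.orbitRel.Quotient H G)) =
      (Finset.univ : Finset H).val.map (fun h => cosetProj H (u * h • v)) := by
  have hF : ‹Fintype H› = Fintype.ofFinite H := Subsingleton.elim _ _
  subst hF
  rfl

/-- The inverse map of the coset group: `inv (π u) = π (u⁻¹)`. -/
def cosetInv (x : MulAction.orbitRel.Quotient H G) : MulAction.orbitRel.Quotient H G :=
  Quotient.lift (fun u : G => cosetProj H u⁻¹) (by
    rintro u v ⟨h, rfl⟩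
    change cosetProj H (h • v)⁻¹ = cosetProj H v⁻¹
    rw [← smul_inv', cosetProj_smul]) x

/-- The coset group of a group `G` and a finite group `H` of automorphisms of `G`: the
`n`-valued group on the set of `H`-orbits in `G`, with `n` the order of `H`. -/
noncomputable def cosetGroup :
    NValuedGroup (Nat.card H) (MulAction.orbitRel.Quotient H G) where
  mul := cosetMul H
  one := cosetProj H 1
  inv := cosetInv H
  mul_assoc := by
    let _ := Fintype.ofFinite H
    intro x y z
    induction x using Quotient.inductionOn with | _ u
    induction y using Quotient.inductionOn with | _ v
    induction z using Quotient.inductionOn with | _ w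
    change Multiset.bind (cosetMul H (cosetProj H v) (cosetProj H w)).toMultiset
        (fun t => (cosetMul H (cosetProj H u) t).toMultiset) =
      Multiset.bind (cosetMul H (cosetProj H u) (cosetProj H v)).toMultiset
        (fun t => (cosetMul H t (cosetProj H w)).toMultiset)
    simp only [coe_cosetMul, Multiset.bind_map]
    rw [Multiset.bind_map_comm]
    refine Multiset.bind_congr fun k _ => ?_
    conv_rhs => rw [← Multiset.map_univ_val_equiv (Equiv.mulLeft k), Multiset.map_map]
    refine Multiset.map_congr rfl fun h _ => ?_
    simp [smul_mul', mul_smul, mul_assoc]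
  one_mul := by
    let _ := Fintype.ofFinite H
    intro x
    induction x using Quotient.inductionOn with | _ u
    apply Subtype.ext
    change (cosetMul H (cosetProj H 1) (cosetProj H u)).toMultiset =
      Multiset.replicate (Nat.card H) (cosetProj H u)
    rw [coe_cosetMul]
    simp only [one_mul, cosetProj_smul, Multiset.map_const', Finset.card_val, Finset.card_univ,
      Nat.card_eq_fintype_card]
  mul_one := by
    let _ := Fintype.ofFinite H
    intro x
    induction x using Quotient.inductionOn with | _ u
    apply Subtype.ext
    change (cosetMul H (cosetProj H u) (cosetProj H 1)).toMultiset =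
      Multiset.replicate (Nat.card H) (cosetProj H u)
    rw [coe_cosetMul]
    simp only [smul_one, mul_one, Multiset.map_const', Finset.card_val, Finset.card_univ,
      Nat.card_eq_fintype_card]
  one_mem_inv_mul := by
    let _ := Fintype.ofFinite H
    intro x
    induction x using Quotient.inductionOn with | _ u
    change cosetProj H 1 ∈ (cosetMul H (cosetProj H u⁻¹) (cosetProj H u)).toMultiset
    rw [coe_cosetMul]
    exact Multiset.mem_map.2 ⟨1, Finset.mem_univ _, by simp⟩
  one_mem_mul_inv := by
    let _ := Fintype.ofFinite H
    intro x
    induction x using Quotient.inductionOn with | _ u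
    change cosetProj H 1 ∈ (cosetMul H (cosetProj H u) (cosetProj H u⁻¹)).toMultiset
    rw [coe_cosetMul]
    exact Multiset.mem_map.2 ⟨1, Finset.mem_univ _, by simp⟩

end Coset

section FreeProduct

/-- The free product `ℤ/m * ℤ/m = ⟨a, b | a ^ m = b ^ m = 1⟩`. -/
abbrev CyclicFreeProduct (m : ℕ) : Type :=
  Monoid.CoprodI (fun _ : Bool => Multiplicative (ZMod m))

/-- The standard generators of `ℤ/m * ℤ/m`: `a` for the letter `false`, `b` for `true`. -/
def letterGen (m : ℕ) (i : Bool) : CyclicFreeProduct m :=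
  Monoid.CoprodI.of (M := fun _ : Bool => Multiplicative (ZMod m)) (i := i)
    (Multiplicative.ofAdd (1 : ZMod m))

/-- The endomorphism of `ℤ/m * ℤ/m` that exchanges the two factors. -/
def swapHom (m : ℕ) : CyclicFreeProduct m →* CyclicFreeProduct m :=
  Monoid.CoprodI.lift fun i =>
    Monoid.CoprodI.of (M := fun _ : Bool => Multiplicative (ZMod m)) (i := !i)

theorem swapHom_comp_swapHom (m : ℕ) : (swapHom m).comp (swapHom m) = MonoidHom.id _ := by
  apply Monoid.CoprodI.ext_hom
  intro i
  ext x
  cases i <;> simp [swapHom]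

/-- The automorphism `φ` of `ℤ/m * ℤ/m` with `a ↦ b` and `b ↦ a`. -/
def swapAut (m : ℕ) : MulAut (CyclicFreeProduct m) :=
  MonoidHom.toMulEquiv (swapHom m) (swapHom m) (swapHom_comp_swapHom m) (swapHom_comp_swapHom m)

theorem swapAut_letterGen (m : ℕ) (i : Bool) : swapAut m (letterGen m i) = letterGen m (!i) := by
  change swapHom m (letterGen m i) = _
  simp [swapHom, letterGen]

theorem swapAut_pow_two (m : ℕ) : swapAut m ^ 2 = 1 := by
  ext x
  rw [pow_two]
  exact DFunLike.congr_fun (swapHom_comp_swapHom m) x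

/-- The group of automorphisms generated by `φ`. -/
abbrev swapGroup (m : ℕ) : Subgroup (MulAut (CyclicFreeProduct m)) :=
  Subgroup.zpowers (swapAut m)

instance finite_swapGroup (m : ℕ) : Finite (swapGroup m) :=
  isOfFinOrder_iff_pow_eq_one.2 ⟨2, two_pos, swapAut_pow_two m⟩ |>.finite_zpowers

/-- The coset group of `ℤ/m * ℤ/m` under the automorphism `a ↔ b`. It is `2`-valued as soon as
`φ` has order two. -/
noncomputable def swapCosetGroup (m : ℕ) :
    NValuedGroup (Nat.card (swapGroup m))
      (MulAction.orbitRel.Quotient (swapGroup m) (CyclicFreeProduct m)) :=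
  cosetGroup (swapGroup m)

/-- The element `g = [a, b]` of the coset group: the orbit of the generator `a`. -/
def swapCosetGen (m : ℕ) : MulAction.orbitRel.Quotient (swapGroup m) (CyclicFreeProduct m) :=
  cosetProj (swapGroup m) (letterGen m false)

/-- The growth function `ξ_k` of the coset group of `ℤ/m * ℤ/m`, with respect to `g = [a, b]`. -/
noncomputable def swapGrowth (m k : ℕ) : ℕ :=
  (swapCosetGroup m).growth (swapCosetGen m) k

/-- A word in the letters `a` and `b` is in normal form `a ^ k₁ b ^ k₂ a ^ k₃ ...` (or the same
with `a` and `b` exchanged) with all exponents in `{1, ..., m - 1}`: no letter occurs `m` times in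
a row. -/
def IsNormalWord (m : ℕ) (w : List Bool) : Prop :=
  ∀ i : Bool, ¬ List.replicate m i <:+: w

/-- The element of `ℤ/m * ℤ/m` represented by a word. -/
def wordElem (m : ℕ) (w : List Bool) : CyclicFreeProduct m :=
  (w.map (letterGen m)).prod

/-- The number `S_k` of distinct words of length `k` in the multiset `[a, b] ^ k`: the number of
different points of `g ^ k` that are represented by a normal form word of length `k`. -/
noncomputable def swapWordCount (m k : ℕ) : ℕ :=
  Set.ncard {x | x ∈ (swapCosetGroup m).pow (swapCosetGen m) k ∧
    ∃ w : List Bool, IsNormalWord m w ∧ w.length = k ∧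
      cosetProj (swapGroup m) (wordElem m w) = x}

end FreeProduct

/-- `F` is the `n`-bonacci sequence (`n ≥ 1`): `F 0 = ... = F (n - 2) = 0`, `F (n - 1) = 1`, and
every later term is the sum of the `n` terms before it. -/
def IsBonacci (n : ℕ) (F : ℕ → ℤ) : Prop :=
  (∀ i, i + 1 < n → F i = 0) ∧ F (n - 1) = 1 ∧
    ∀ k, F (k + n) = ∑ i ∈ Finset.range n, F (k + i)

/-- The characteristic polynomial `X ^ n - X ^ (n - 1) - ... - X - 1` of the `n`-bonacci
recurrence. -/
noncomputable def bonacciCharPoly (n : ℕ) : Polynomial ℝ :=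
  Polynomial.X ^ n - ∑ i ∈ Finset.range n, Polynomial.X ^ i

/-- A function on the natural numbers has polynomial growth: it is `O(k ^ d)` for some `d`. -/
def HasPolynomialGrowth (f : ℕ → ℕ) : Prop :=
  ∃ d : ℕ, (fun k => (f k : ℝ)) =O[atTop] fun k => (k : ℝ) ^ d

/-! ### Counting normal form words by a run-length recurrence -/

section NormalWords

/-! Put `n = m - 1`. Up to `φ`, left multiplication by `g` prepends either letter, so `g ^ k`
consists of the orbits of all words of length `k` (`mem_pow_swapCosetGen`). Deleting blocks of `m`
equal letters makes a word normal without lengthening it, distinct normal words are distinct group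
elements (`wordElem_injOn`), and `φ` exchanges the letters. Hence the orbits correspond to the
normal words not starting with `b`: `S_k` counts those of length `k`, and `ξ_k` is the sum of `S_j`
over `j ≤ k` (`swapWordCount_eq`, `swapGrowth_eq`).

How a word may continue depends only on the length of its current run, and this gives the
`n`-bonacci recurrence for `S_k` padded by zeros (`isBonacci_paddedCount`). Its partial sums satisfy
the same recurrence up to the constant 1, which a shift by `1 / (n - 1)` absorbs when `n ≥ 2`.

For the asymptotics no other root of the characteristic polynomial is needed. Dividing a solution by
`r ^ k` turns the recurrence into a positive weighted average, so oscillations die out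
(`exists_window_bounds`); the left eigenvector of the recurrence for `r` gives a conserved positive
combination, which identifies the limit (`tendsto_bonacci_div_pow`). Since `r > 1`, growth is
exponential for `m ≥ 3`; for `m = 2` every `S_k` is 1 and `ξ_k = k + 1`. -/

theorem isNormalWord_nil {m : ℕ} (hm : m ≠ 0) : IsNormalWord m [] := by
  intro i h
  simpa [hm] using List.infix_nil.1 h

theorem isNormalWord_cons {m : ℕ} {x : Bool} {w : List Bool} (hm : m ≠ 0) :
    IsNormalWord m (x :: w) ↔ ¬ List.replicate m x <+: x :: w ∧ IsNormalWord m w := by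
  obtain ⟨m, rfl⟩ := Nat.exists_eq_succ_of_ne_zero hm
  simp only [IsNormalWord, List.infix_cons_iff, not_or]
  constructor
  · exact fun h => ⟨(h x).1, fun i => (h i).2⟩
  · rintro ⟨h1, h2⟩ i
    refine ⟨fun h => ?_, h2 i⟩
    obtain rfl : i = x := by
      rw [List.replicate_succ, List.cons_prefix_cons] at h
      exact h.1
    exact h1 h

theorem isNormalWord_map_not {m : ℕ} {w : List Bool} :
    IsNormalWord m (w.map not) ↔ IsNormalWord m w := by
  have key : ∀ w : List Bool, IsNormalWord m w → IsNormalWord m (w.map not) := by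
    intro w h i hi
    apply h (!i)
    have := hi.map not
    simpa [Function.comp_def] using this
  refine ⟨fun h => ?_, key w⟩
  simpa [Function.comp_def] using key _ h

theorem replicate_prefix_replicate_append_cons {m j : ℕ} {x y : Bool} (hxy : x ≠ y)
    {w : List Bool} : List.replicate m x <+: List.replicate j x ++ y :: w ↔ m ≤ j := by
  constructor
  · intro h
    induction j generalizing m with
    | zero =>
      cases m with
      | zero => simp
      | succ m => simp [List.replicate_succ, hxy] at h
    | succ j ih =>
      cases m with
      | zero => simp
      | succ m =>
        simp only [List.replicate_succ, List.cons_append, List.cons_prefix_cons, true_and] at h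
        exact Nat.succ_le_succ (ih h)
  · intro h
    refine List.IsPrefix.trans ?_ (List.prefix_append _ _)
    rw [List.prefix_replicate_iff]
    simpa using h

/-- The letter `y` closes the run of `x`, so what precedes it matters only through the length of
that run. -/
theorem isNormalWord_replicate_append_cons {m j : ℕ} {x y : Bool} (hxy : x ≠ y) (hm : m ≠ 0)
    {w : List Bool} :
    IsNormalWord m (List.replicate j x ++ y :: w) ↔ j < m ∧ IsNormalWord m (y :: w) := by
  induction j with
  | zero => simp [Nat.pos_of_ne_zero hm]
  | succ j ih =>
    rw [List.replicate_succ, List.cons_append, isNormalWord_cons hm, ih, ← List.cons_append,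
      ← List.replicate_succ, replicate_prefix_replicate_append_cons hxy]
    constructor
    · rintro ⟨h, -, h2⟩
      exact ⟨by omega, h2⟩
    · rintro ⟨h, h2⟩
      exact ⟨by omega, by omega, h2⟩

theorem isNormalWord_replicate {m j : ℕ} {x : Bool} :
    IsNormalWord m (List.replicate j x) ↔ j < m := by
  constructor
  · intro h
    by_contra! hj
    refine h x (List.IsPrefix.isInfix ?_)
    rw [List.prefix_replicate_iff]
    simpa using hj
  · rintro hj i ⟨s, t, h⟩
    have := congrArg List.length h
    simp at this
    omega

/-- The words `w` of length `k` for which `a ^ j w` is in normal form. -/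
def normalExtensions (m j k : ℕ) : Set (List Bool) :=
  {w | w.length = k ∧ IsNormalWord m (List.replicate j false ++ w)}

/-- The words of length `k` in normal form that do not start with `b`. -/
def normalRepresentatives (m k : ℕ) : Set (List Bool) :=
  {w | w.length = k ∧ IsNormalWord m w ∧ w.head? ≠ some true}

theorem finite_normalExtensions (m j k : ℕ) : (normalExtensions m j k).Finite :=
  (List.finite_length_eq Bool k).subset fun _ h => h.1

theorem finite_normalRepresentatives (m k : ℕ) : (normalRepresentatives m k).Finite :=
  (List.finite_length_eq Bool k).subset fun _ h => h.1

theorem normalRepresentatives_zero {m : ℕ} (hm : m ≠ 0) : normalRepresentatives m 0 = {[]} := by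
  ext w
  simp only [normalRepresentatives, List.length_eq_zero_iff, Set.mem_ofPred_eq,
    Set.mem_singleton_iff]
  constructor
  · exact fun h => h.1
  · rintro rfl
    exact ⟨rfl, isNormalWord_nil hm, by simp⟩

theorem ncard_normalRepresentatives_succ (m k : ℕ) :
    (normalRepresentatives m (k + 1)).ncard = (normalExtensions m 1 k).ncard := by
  have : normalRepresentatives m (k + 1) = List.cons false '' normalExtensions m 1 k := by
    ext w
    cases w with
    | nil => simp [normalRepresentatives]
    | cons x w => cases x <;> simp [normalRepresentatives, normalExtensions, List.replicate_succ]
  rw [this, Set.ncard_image_of_injective _ List.cons_injective]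

/-- The next letter either lengthens the run of `a` or opens a run of `b` of length 1; exchanging
the letters turns the latter into a run of `a`. -/
theorem normalExtensions_succ {m j k : ℕ} (hm : m ≠ 0) (hj : j < m) :
    normalExtensions m j (k + 1) = List.cons false '' normalExtensions m (j + 1) k ∪
      (fun w => true :: w.map not) '' normalExtensions m 1 k := by
  ext w
  cases w with
  | nil => simp [normalExtensions]
  | cons x w =>
    cases x with
    | false =>
      have : List.replicate j false ++ false :: w = List.replicate (j + 1) false ++ w := by
        rw [List.replicate_succ', List.append_assoc]; rfl
      simp [normalExtensions, this]
    | true =>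
      have h2 : ∀ u : List Bool, u.map not = w ↔ u = w.map not := by
        intro u
        constructor <;> rintro rfl <;> simp [Function.comp_def]
      have h3 : IsNormalWord m (false :: w.map not) ↔ IsNormalWord m (true :: w) := by
        rw [← isNormalWord_map_not (w := true :: w)]; rfl
      simp [normalExtensions, isNormalWord_replicate_append_cons, hm, hj, h2, h3]

theorem ncard_normalExtensions_succ {m j k : ℕ} (hm : m ≠ 0) (hj : j < m) :
    (normalExtensions m j (k + 1)).ncard =
      (normalExtensions m (j + 1) k).ncard + (normalExtensions m 1 k).ncard := by
  rw [normalExtensions_succ hm hj, Set.ncard_union_eq _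
    ((finite_normalExtensions m _ k).image _) ((finite_normalExtensions m _ k).image _),
    Set.ncard_image_of_injective _ List.cons_injective, Set.ncard_image_of_injective]
  · intro u v h
    have h2 : u.map not = v.map not := by simpa using h
    exact List.map_injective_iff.2 Bool.not_injective h2
  · rw [Set.disjoint_left]
    rintro _ ⟨u, -, rfl⟩ ⟨v, -, h⟩
    simp at h

theorem normalExtensions_zero {m j : ℕ} (hj : j < m) :
    normalExtensions m j 0 = {[]} := by
  ext w
  simp only [normalExtensions, List.length_eq_zero_iff, Set.mem_ofPred_eq, Set.mem_singleton_iff]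
  constructor
  · exact fun h => h.1
  · rintro rfl
    simp [isNormalWord_replicate, hj]

theorem normalExtensions_self {m k : ℕ} : normalExtensions m m k = ∅ := by
  ext w
  simp only [normalExtensions, Set.mem_ofPred_eq, Set.mem_empty_iff_false, iff_false, not_and]
  intro _ h
  exact h false (List.prefix_append _ _).isInfix

/-- The sequence of the numbers of normal representatives, preceded by `n - 1` zeros. -/
noncomputable def paddedCount (n k : ℕ) : ℕ :=
  if k + 1 < n then 0 else (normalRepresentatives (n + 1) (k + 1 - n)).ncard

theorem paddedCount_of_lt {n k : ℕ} (h : k + 1 < n) : paddedCount n k = 0 := if_pos h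

theorem paddedCount_add {n : ℕ} (hn : n ≠ 0) (k : ℕ) :
    paddedCount n (k + (n - 1)) = (normalRepresentatives (n + 1) k).ncard := by
  rw [paddedCount, if_neg (by omega)]
  congr 2
  omega

theorem paddedCount_sub_one {n : ℕ} (hn : n ≠ 0) : paddedCount n (n - 1) = 1 := by
  have := paddedCount_add hn 0
  rwa [zero_add, normalRepresentatives_zero (by omega), Set.ncard_singleton] at this

theorem paddedCount_add_self {n : ℕ} (hn : n ≠ 0) (k : ℕ) :
    paddedCount n (k + n) = (normalExtensions (n + 1) 1 k).ncard := by
  rw [← ncard_normalRepresentatives_succ, ← paddedCount_add hn]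
  congr 1
  omega

/-- Let `E j k` count the continuations of length `k` after a run of length `j`, so that `E (j + 1)
(k + 1) = E (j + 2) k + E 1 k`. By induction the first term is the reindexed sum without its top
summand, and `E 1 k = paddedCount n (k + n)` is that summand. The padding zeros make `k = 0` fit. -/
theorem ncard_normalExtensions_eq_sum {n : ℕ} (hn : n ≠ 0) (k : ℕ) :
    ∀ j ≤ n, (normalExtensions (n + 1) (j + 1) k).ncard =
      ∑ i ∈ Finset.Ico j n, paddedCount n (k + i) := by
  induction k with
  | zero =>
    intro j hj
    obtain rfl | hj := hj.eq_or_lt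
    · simp [normalExtensions_self]
    · rw [normalExtensions_zero (by omega), Set.ncard_singleton,
        Finset.sum_eq_single (n - 1)]
      · rw [zero_add, paddedCount_sub_one hn]
      · intro i hi hne
        rw [Finset.mem_Ico] at hi
        exact paddedCount_of_lt (by omega)
      · intro h
        simp only [Finset.mem_Ico, not_and, not_lt] at h
        omega
  | succ k ih =>
    intro j hj
    obtain rfl | hj := hj.eq_or_lt
    · simp [normalExtensions_self]
    · rw [ncard_normalExtensions_succ (by omega) (by omega), ih (j + 1) hj,
        ← paddedCount_add_self hn, ← Finset.sum_Ico_succ_top (by omega),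
        ← Finset.sum_Ico_add' (fun i => paddedCount n (k + i)) j n 1]
      exact Finset.sum_congr rfl fun i _ => by congr 1; omega

theorem paddedCount_add_self_eq_sum {n : ℕ} (hn : n ≠ 0) (k : ℕ) :
    paddedCount n (k + n) = ∑ i ∈ Finset.range n, paddedCount n (k + i) := by
  rw [paddedCount_add_self hn, ncard_normalExtensions_eq_sum hn k 0 (Nat.zero_le n),
    Finset.range_eq_Ico]

theorem isBonacci_paddedCount {n : ℕ} (hn : n ≠ 0) :
    IsBonacci n fun k => (paddedCount n k : ℤ) :=
  ⟨fun _ h => by simp [paddedCount_of_lt h], by simp [paddedCount_sub_one hn],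
    fun k => by simp [paddedCount_add_self_eq_sum hn k]⟩

end NormalWords

/-! ### Normal words as representatives of group elements and orbits -/

section WordElem

variable {m : ℕ}

@[simp]
theorem wordElem_nil : wordElem m [] = 1 := rfl

@[simp]
theorem wordElem_cons (x : Bool) (w : List Bool) :
    wordElem m (x :: w) = letterGen m x * wordElem m w := by
  simp [wordElem]

theorem wordElem_append (u v : List Bool) :
    wordElem m (u ++ v) = wordElem m u * wordElem m v := by
  simp [wordElem]

theorem wordElem_replicate_self (x : Bool) : wordElem m (List.replicate m x) = 1 := by
  rw [wordElem, List.map_replicate, List.prod_replicate, letterGen, ← map_pow, ← ofAdd_nsmul]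
  simp

theorem swapAut_wordElem (w : List Bool) :
    swapAut m (wordElem m w) = wordElem m (w.map not) := by
  induction w with
  | nil => simp
  | cons x w ih => simp [swapAut_letterGen, ih]

theorem exists_isNormalWord_wordElem_eq (hm : m ≠ 0) (w : List Bool) :
    ∃ u, IsNormalWord m u ∧ u.length ≤ w.length ∧ wordElem m u = wordElem m w := by
  induction h : w.length using Nat.strong_induction_on generalizing w with
  | _ k ih =>
    by_cases hw : IsNormalWord m w
    · exact ⟨w, hw, h.le, rfl⟩
    · simp only [IsNormalWord, not_forall, not_not] at hw
      obtain ⟨i, s, t, rfl⟩ := hw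
      simp only [List.length_append, List.length_replicate] at h
      obtain ⟨u, h1, h2, h3⟩ := ih (s ++ t).length (by simp; omega) (s ++ t) rfl
      refine ⟨u, h1, h2.trans (by simp; omega), h3.trans ?_⟩
      simp [wordElem_append, wordElem_replicate_self]

/-- The word in the letters `a` and `b` that spells a reduced word of `ℤ/m * ℤ/m`. -/
def spellWord (V : Monoid.CoprodI.Word fun _ : Bool => Multiplicative (ZMod m)) : List Bool :=
  V.toList.flatMap fun l => List.replicate (ZMod.val (Multiplicative.toAdd l.2)) l.1

theorem spellWord_rcons {i : Bool}
    (p : Monoid.CoprodI.Word.Pair (fun _ : Bool => Multiplicative (ZMod m)) i) :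
    spellWord (Monoid.CoprodI.Word.rcons p) =
      List.replicate (ZMod.val (Multiplicative.toAdd p.head)) i ++ spellWord p.tail := by
  by_cases h : p.head = 1
  · simp [Monoid.CoprodI.Word.rcons, h]
  · simp [Monoid.CoprodI.Word.rcons, h, spellWord]

/-- The action of the free product on its reduced words recovers a normal word from the element it
represents; this is the source of injectivity. -/
theorem spellWord_wordElem_smul_empty (hm : 2 ≤ m) {w : List Bool} (hw : IsNormalWord m w) :
    spellWord (wordElem m w • (Monoid.CoprodI.Word.empty :
      Monoid.CoprodI.Word fun _ : Bool => Multiplicative (ZMod m))) = w := by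
  have : Fact (1 < m) := ⟨hm⟩
  induction w with
  | nil => simp [spellWord]
  | cons x w ih =>
    obtain ⟨h1, h2⟩ := (isNormalWord_cons (by omega)).1 hw
    specialize ih h2
    rw [wordElem_cons, mul_smul]
    set V := wordElem m w • Monoid.CoprodI.Word.empty (M := fun _ : Bool => Multiplicative (ZMod m))
    have hV : V = Monoid.CoprodI.Word.rcons (Monoid.CoprodI.Word.equivPair x V) :=
      ((Monoid.CoprodI.Word.equivPair x).symm_apply_apply V).symm
    rw [hV, spellWord_rcons] at ih
    set p := Monoid.CoprodI.Word.equivPair x V with hp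
    -- Normality bounds the leading exponent, so adding 1 to it does not wrap around in `ZMod m`.
    have hlt : ZMod.val (Multiplicative.toAdd p.head) + 1 < m := by
      by_contra! hge
      refine h1 ?_
      rw [← ih, ← List.cons_append, ← List.replicate_succ]
      refine List.IsPrefix.trans ?_ (List.prefix_append _ _)
      rw [List.prefix_replicate_iff]
      simpa using hge
    rw [letterGen, Monoid.CoprodI.Word.of_smul_def, ← hp, spellWord_rcons]
    have hval : ZMod.val (Multiplicative.toAdd (Multiplicative.ofAdd (1 : ZMod m) * p.head)) =
        ZMod.val (Multiplicative.toAdd p.head) + 1 := by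
      rw [toAdd_mul, toAdd_ofAdd, add_comm, ZMod.val_add_of_lt, ZMod.val_one]
      rwa [ZMod.val_one]
    dsimp only
    rw [hval, List.replicate_succ, List.cons_append, ih]

theorem wordElem_injOn (hm : 2 ≤ m) : Set.InjOn (wordElem m) {w | IsNormalWord m w} := by
  intro u hu v hv h
  rw [← spellWord_wordElem_smul_empty hm hu, h, spellWord_wordElem_smul_empty hm hv]

theorem swapAut_ne_one (hm : 2 ≤ m) : swapAut m ≠ 1 := by
  intro h
  have h1 := swapAut_wordElem (m := m) [false]
  rw [h] at h1
  have h2 (x : Bool) : IsNormalWord m [x] := by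
    simpa using (isNormalWord_replicate (m := m) (j := 1) (x := x)).2 hm
  simpa using wordElem_injOn hm (h2 false) (h2 true) h1

theorem orderOf_swapAut (hm : 2 ≤ m) : orderOf (swapAut m) = 2 :=
  orderOf_eq_prime (swapAut_pow_two m) (swapAut_ne_one hm)

theorem card_swapGroup (hm : 2 ≤ m) : Nat.card (swapGroup m) = 2 := by
  rw [Nat.card_zpowers, orderOf_swapAut hm]

theorem eq_one_or_eq_swapAut {h : MulAut (CyclicFreeProduct m)} (hh : h ∈ swapGroup m) :
    h = 1 ∨ h = swapAut m := by
  obtain ⟨k, rfl⟩ := hh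
  obtain ⟨l, rfl | rfl⟩ := Int.even_or_odd' k
  · left
    simp [zpow_mul, swapAut_pow_two, zpow_ofNat]
  · right
    simp [zpow_add, zpow_mul, swapAut_pow_two, zpow_ofNat]

theorem cosetProj_swapAut (u : CyclicFreeProduct m) :
    cosetProj (swapGroup m) (swapAut m u) = cosetProj (swapGroup m) u :=
  cosetProj_smul (swapGroup m) ⟨swapAut m, Subgroup.mem_zpowers _⟩ u

theorem cosetProj_eq_iff {u v : CyclicFreeProduct m} :
    cosetProj (swapGroup m) u = cosetProj (swapGroup m) v ↔ u = v ∨ u = swapAut m v := by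
  constructor
  · intro h
    obtain ⟨⟨k, hk⟩, rfl⟩ := Quotient.exact h
    obtain rfl | rfl := eq_one_or_eq_swapAut hk
    · exact Or.inl rfl
    · exact Or.inr rfl
  · rintro (rfl | rfl)
    · rfl
    · exact cosetProj_swapAut v

theorem mem_mul_swapCosetGen {x : MulAction.orbitRel.Quotient (swapGroup m) (CyclicFreeProduct m)}
    {v : CyclicFreeProduct m} :
    x ∈ ((swapCosetGroup m).mul (swapCosetGen m) (cosetProj (swapGroup m) v) : Multiset _) ↔
      ∃ i, x = cosetProj (swapGroup m) (letterGen m i * v) := by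
  have := Fintype.ofFinite (swapGroup m)
  change x ∈ (cosetMul (swapGroup m) (cosetProj (swapGroup m) (letterGen m false))
    (cosetProj (swapGroup m) v) : Multiset _) ↔ _
  rw [coe_cosetMul, Multiset.mem_map]
  -- The second value of the product: `φ` carries `a * φ v` to `b * v` within the same orbit.
  have key : cosetProj (swapGroup m) (letterGen m false * swapAut m v) =
      cosetProj (swapGroup m) (letterGen m true * v) := by
    rw [← cosetProj_swapAut, map_mul, swapAut_letterGen, ← MulAut.mul_apply, ← pow_two,
      swapAut_pow_two]
    rfl
  constructor
  · rintro ⟨⟨h, hh⟩, -, rfl⟩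
    obtain rfl | rfl := eq_one_or_eq_swapAut hh
    · exact ⟨false, rfl⟩
    · exact ⟨true, key⟩
  · rintro ⟨i, rfl⟩
    cases i
    · exact ⟨1, Finset.mem_univ _, by simp⟩
    · exact ⟨⟨swapAut m, Subgroup.mem_zpowers _⟩, Finset.mem_univ _, key⟩

theorem mem_pow_swapCosetGen {x : MulAction.orbitRel.Quotient (swapGroup m) (CyclicFreeProduct m)}
    {k : ℕ} : x ∈ (swapCosetGroup m).pow (swapCosetGen m) k ↔
      ∃ w : List Bool, w.length = k ∧ cosetProj (swapGroup m) (wordElem m w) = x := by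
  induction k generalizing x with
  | zero =>
    change x ∈ ({cosetProj (swapGroup m) 1} : Multiset _) ↔ _
    simp [eq_comm]
  | succ k ih =>
    change x ∈ Multiset.bind ((swapCosetGroup m).pow (swapCosetGen m) k) _ ↔ _
    rw [Multiset.mem_bind]
    constructor
    · rintro ⟨y, hy, hx⟩
      obtain ⟨w, rfl, rfl⟩ := ih.1 hy
      obtain ⟨i, rfl⟩ := mem_mul_swapCosetGen.1 hx
      exact ⟨i :: w, rfl, by simp⟩
    · rintro ⟨w, hw, rfl⟩
      cases w with
      | nil => simp at hw
      | cons i w =>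
        refine ⟨_, ih.2 ⟨w, by simpa using hw, rfl⟩, mem_mul_swapCosetGen.2 ⟨i, by simp⟩⟩

theorem cosetProj_wordElem_injOn (hm : 2 ≤ m) :
    Set.InjOn (fun w => cosetProj (swapGroup m) (wordElem m w))
      {w | IsNormalWord m w ∧ w.head? ≠ some true} := by
  rintro u ⟨hu, hu'⟩ v ⟨hv, hv'⟩ h
  obtain h | h := cosetProj_eq_iff.1 h
  · exact wordElem_injOn hm hu hv h
  · rw [swapAut_wordElem] at h
    have h := wordElem_injOn hm hu (isNormalWord_map_not.2 hv) h
    subst h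
    -- Both `v` and its letter exchange avoid a leading `b`, which only the empty word can do.
    rcases v with _ | ⟨x, v⟩
    · rfl
    · cases x <;> simp at hu' hv'

theorem exists_normalRepresentative {u : List Bool} (hu : IsNormalWord m u) :
    ∃ v ∈ normalRepresentatives m u.length,
      cosetProj (swapGroup m) (wordElem m v) = cosetProj (swapGroup m) (wordElem m u) := by
  by_cases h : u.head? = some true
  · refine ⟨u.map not, ⟨by simp, isNormalWord_map_not.2 hu, by simp [h]⟩, ?_⟩
    rw [← swapAut_wordElem, cosetProj_swapAut]
  · exact ⟨u, ⟨rfl, hu, h⟩, rfl⟩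

theorem swapWordCount_eq (hm : 2 ≤ m) (k : ℕ) :
    swapWordCount m k = (normalRepresentatives m k).ncard := by
  rw [swapWordCount, ← Set.InjOn.ncard_image
    ((cosetProj_wordElem_injOn hm).mono fun w (hw : w ∈ normalRepresentatives m k) => hw.2)]
  congr 1
  ext x
  constructor
  · rintro ⟨-, u, hu, rfl, rfl⟩
    exact exists_normalRepresentative hu
  · rintro ⟨u, hu, rfl⟩
    exact ⟨mem_pow_swapCosetGen.2 ⟨u, hu.1, rfl⟩, u, hu.2.1, hu.1, rfl⟩

theorem swapGrowth_eq (hm : 2 ≤ m) (k : ℕ) :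
    swapGrowth m k = ∑ j ∈ Finset.range (k + 1), (normalRepresentatives m j).ncard := by
  have hfin (j : ℕ) := finite_normalRepresentatives m j
  have hunion : (⋃ j ∈ Finset.range (k + 1), normalRepresentatives m j).ncard =
      ∑ j ∈ Finset.range (k + 1), (normalRepresentatives m j).ncard := by
    simp only [Set.ncard_eq_toFinset_card _ (hfin _)]
    rw [← Finset.card_biUnion, ← Set.ncard_coe_finset]
    · simp
    · intro i _ j _ hij
      rw [Function.onFun, Finset.disjoint_left]
      intro w hi hj
      rw [Set.Finite.mem_toFinset] at hi hj
      exact hij (hi.1.symm.trans hj.1)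
  rw [← hunion, swapGrowth, NValuedGroup.growth, dynamicsGrowth, ← Set.InjOn.ncard_image
    ((cosetProj_wordElem_injOn hm).mono ?_)]
  · congr 1
    ext x
    constructor
    · rintro ⟨i, hi, hx⟩
      obtain ⟨w, rfl, rfl⟩ := mem_pow_swapCosetGen.1 hx
      obtain ⟨u, hu, hle, he⟩ := exists_isNormalWord_wordElem_eq (m := m) (by omega) w
      obtain ⟨v, hv, hve⟩ := exists_normalRepresentative hu
      refine ⟨v, ?_, by rw [← he, ← hve]⟩
      simp only [Set.mem_iUnion]
      exact ⟨u.length, Finset.mem_range.2 (by omega), hv⟩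
    · rintro ⟨u, hu, rfl⟩
      simp only [Set.mem_iUnion] at hu
      obtain ⟨j, hj, hu⟩ := hu
      exact ⟨j, Nat.lt_succ_iff.1 (Finset.mem_range.1 hj),
        mem_pow_swapCosetGen.2 ⟨u, hu.1, rfl⟩⟩
  · intro w hw
    simp only [Set.mem_iUnion] at hw
    obtain ⟨j, -, hw⟩ := hw
    exact hw.2

end WordElem

/-! ### Contraction of oscillation under positive averaging -/

section Averages

variable {n : ℕ} {a e : ℕ → ℝ} {δ : ℝ}

theorem weighted_sum_le (ha : ∀ i < n, δ ≤ a i) (hδ : 0 ≤ δ)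
    (hsum : ∑ i ∈ Finset.range n, a i = 1) {f : ℕ → ℝ} {B C : ℝ} (hCB : C ≤ B)
    (hf : ∀ i < n, f i ≤ B) {i₀ : ℕ} (hi₀ : i₀ < n) (hC : f i₀ ≤ C) :
    ∑ i ∈ Finset.range n, a i * f i ≤ B - δ * (B - C) := by
  have h1 : a i₀ * (B - f i₀) ≤ ∑ i ∈ Finset.range n, a i * (B - f i) :=
    Finset.single_le_sum (f := fun i => a i * (B - f i))
      (fun i hi => mul_nonneg (hδ.trans (ha i (Finset.mem_range.1 hi)))
        (sub_nonneg.2 (hf i (Finset.mem_range.1 hi)))) (Finset.mem_range.2 hi₀)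
  have h2 : δ * (B - C) ≤ a i₀ * (B - f i₀) :=
    mul_le_mul (ha i₀ hi₀) (by linarith) (by linarith) (hδ.trans (ha i₀ hi₀))
  simp only [mul_sub, Finset.sum_sub_distrib, ← Finset.sum_mul, hsum] at h1
  linarith

theorem le_of_window_le (ha : ∀ i < n, 0 ≤ a i) (hsum : ∑ i ∈ Finset.range n, a i = 1)
    (he : ∀ k, e (k + n) = ∑ i ∈ Finset.range n, a i * e (k + i)) {k : ℕ} {B : ℝ}
    (hB : ∀ i < n, e (k + i) ≤ B) (j : ℕ) : e (k + j) ≤ B := by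
  induction j using Nat.strong_induction_on with
  | _ j ih =>
    rcases lt_or_ge j n with h | h
    · exact hB j h
    · obtain ⟨l, rfl⟩ := Nat.exists_eq_add_of_le' h
      rw [← add_assoc, he]
      calc ∑ i ∈ Finset.range n, a i * e (k + l + i) ≤ ∑ i ∈ Finset.range n, a i * B := by
            refine Finset.sum_le_sum fun i hi => ?_
            rw [Finset.mem_range] at hi
            refine mul_le_mul_of_nonneg_left ?_ (ha i hi)
            rw [add_assoc]
            exact ih _ (by omega)
        _ = B := by rw [← Finset.sum_mul, hsum, one_mul]

/-- One low term pulls `e (k + n)` down by a factor `δ` of the gap; `e (k + n)` lies in the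
averaging window of each of the `n` terms after it, which costs a second factor `δ`. A full window
below the new bound stays below it. -/
theorem le_sub_of_window_le (ha : ∀ i < n, δ ≤ a i) (hδ : 0 ≤ δ) (hn : 0 < n)
    (hsum : ∑ i ∈ Finset.range n, a i = 1)
    (he : ∀ k, e (k + n) = ∑ i ∈ Finset.range n, a i * e (k + i)) {k : ℕ} {B C : ℝ} (hCB : C ≤ B)
    (hB : ∀ j, k ≤ j → e j ≤ B) (hC : e k ≤ C) (j : ℕ) (hj : k + (n + 1) ≤ j) :
    e j ≤ B - δ ^ 2 * (B - C) := by
  have h1 : e (k + n) ≤ B - δ * (B - C) := by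
    rw [he]
    exact weighted_sum_le ha hδ hsum hCB (fun i _ => hB _ (by omega)) hn hC
  have h2 : ∀ i < n, e (k + (n + 1) + i) ≤ B - δ ^ 2 * (B - C) := by
    intro i hi
    have h3 : k + (n + 1) + i = (k + 1 + i) + n := by omega
    rw [h3, he]
    have h4 : B - δ * (B - C) ≤ B := by nlinarith
    refine (weighted_sum_le ha hδ hsum h4 (fun i _ => hB _ (by omega)) (i₀ := n - 1 - i)
      (by omega) ?_).trans (by nlinarith)
    have h5 : k + 1 + i + (n - 1 - i) = k + n := by omega
    rwa [h5]
  obtain ⟨l, rfl⟩ := Nat.exists_eq_add_of_le hj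
  exact le_of_window_le (fun i hi => hδ.trans (ha i hi)) hsum he h2 l

theorem exists_window_bounds (ha : ∀ i < n, δ ≤ a i) (hδ : 0 ≤ δ) (hn : 0 < n)
    (hsum : ∑ i ∈ Finset.range n, a i = 1)
    (he : ∀ k, e (k + n) = ∑ i ∈ Finset.range n, a i * e (k + i)) :
    ∃ D : ℝ, ∀ p : ℕ, ∃ A B : ℝ, B - A = (1 - δ ^ 2 / 2) ^ p * D ∧
      ∀ j, p * (n + 1) ≤ j → A ≤ e j ∧ e j ≤ B := by
  have he' : ∀ k, (-e) (k + n) = ∑ i ∈ Finset.range n, a i * (-e) (k + i) := by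
    intro k
    simp [he]
  have ha' : ∀ i < n, 0 ≤ a i := fun i hi => hδ.trans (ha i hi)
  set M := ∑ i ∈ Finset.range n, |e i| with hM
  have hMi : ∀ i < n, |e i| ≤ M := fun i hi =>
    Finset.single_le_sum (f := fun i => |e i|) (fun i _ => abs_nonneg _) (Finset.mem_range.2 hi)
  refine ⟨2 * M, fun p => ?_⟩
  induction p with
  | zero =>
    refine ⟨-M, M, by ring, fun j _ => ⟨?_, ?_⟩⟩
    · have := le_of_window_le ha' hsum he' (k := 0) (B := M)
        (fun i hi => by simpa using (neg_le_abs _).trans (hMi i hi)) j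
      simp only [zero_add, Pi.neg_apply] at this
      linarith
    · simpa using le_of_window_le ha' hsum he (k := 0) (B := M)
        (fun i hi => by simpa using (le_abs_self _).trans (hMi i hi)) j
  | succ p ih =>
    obtain ⟨A, B, hAB, h⟩ := ih
    have hle : A ≤ B := (h _ le_rfl).1.trans (h _ le_rfl).2
    -- A term in the lower half lowers `B`; one in the upper half raises `A`, by the same lemma for
    -- `-e`. The gap to the midpoint is `(B - A) / 2`, whence the factor `1 - δ ^ 2 / 2`.
    rcases le_total (e (p * (n + 1))) ((A + B) / 2) with hC | hC
    · refine ⟨A, B - δ ^ 2 * (B - (A + B) / 2), ?_, fun j hj => ⟨(h j ?_).1, ?_⟩⟩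
      · rw [pow_succ]
        linear_combination (1 - δ ^ 2 / 2) * hAB
      · exact le_trans (by gcongr; omega) hj
      · exact le_sub_of_window_le ha hδ hn hsum he (by linarith) (fun j hj => (h j hj).2) hC j
          (by rwa [add_mul, one_mul] at hj)
    · refine ⟨A + δ ^ 2 * (B - (A + B) / 2), B, ?_, fun j hj => ⟨?_, (h j ?_).2⟩⟩
      · rw [pow_succ]
        linear_combination (1 - δ ^ 2 / 2) * hAB
      · have := le_sub_of_window_le ha hδ hn hsum he' (B := -A) (C := -((A + B) / 2))
          (by linarith) (fun j hj => neg_le_neg (h j hj).1) (neg_le_neg hC) j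
          (by rwa [add_mul, one_mul] at hj)
        simp only [Pi.neg_apply] at this
        linarith
      · exact le_trans (by gcongr; omega) hj

/-- A solution of a linear recurrence whose coefficients are those of a positive average tends to
zero if some positive linear combination of `n` consecutive terms always vanishes. -/
theorem tendsto_zero_of_average (hn : 0 < n) (ha : ∀ i < n, 0 < a i)
    (hsum : ∑ i ∈ Finset.range n, a i = 1)
    (he : ∀ k, e (k + n) = ∑ i ∈ Finset.range n, a i * e (k + i))
    {t : ℕ → ℝ} (ht : ∀ i < n, 0 < t i)
    (hte : ∀ k, ∑ i ∈ Finset.range n, t i * e (k + i) = 0) :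
    Tendsto e atTop (nhds 0) := by
  have hne : (Finset.range n).Nonempty := Finset.nonempty_range_iff.2 hn.ne'
  obtain ⟨i₀, hi₀, hmin⟩ := Finset.exists_min_image (Finset.range n) a hne
  have hδ : 0 < a i₀ := ha i₀ (Finset.mem_range.1 hi₀)
  have hδ1 : a i₀ ≤ 1 := by
    rw [← hsum]
    exact Finset.single_le_sum (fun i hi => (ha i (Finset.mem_range.1 hi)).le) hi₀
  obtain ⟨D, hD⟩ := exists_window_bounds (δ := a i₀)
    (fun i hi => hmin i (Finset.mem_range.2 hi)) hδ.le hn hsum he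
  have hq0 : 0 ≤ 1 - a i₀ ^ 2 / 2 := by nlinarith
  have hq1 : 1 - a i₀ ^ 2 / 2 < 1 := by nlinarith
  have hlim : Tendsto (fun p : ℕ => (1 - a i₀ ^ 2 / 2) ^ p * D) atTop (nhds 0) := by
    simpa using (tendsto_pow_atTop_nhds_zero_of_lt_one hq0 hq1).mul_const D
  rw [Metric.tendsto_atTop]
  intro ε hε
  obtain ⟨p, hp⟩ := (hlim.eventually (gt_mem_nhds hε)).exists
  refine ⟨p * (n + 1), fun j hj => ?_⟩
  obtain ⟨A, B, hAB, h⟩ := hD p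
  -- A window of terms of one strict sign would contradict the vanishing positive combination, so 0
  -- lies between the bounds.
  have hA : A ≤ 0 := by
    by_contra! hA
    refine (hte (p * (n + 1))).not_gt (Finset.sum_pos (fun i hi => ?_) hne)
    exact mul_pos (ht i (Finset.mem_range.1 hi)) (hA.trans_le (h _ (by omega)).1)
  have hB : 0 ≤ B := by
    by_contra! hB
    refine (hte (p * (n + 1))).not_lt (Finset.sum_neg (fun i hi => ?_) hne)
    exact mul_neg_of_pos_of_neg (ht i (Finset.mem_range.1 hi))
      ((h _ (by omega)).2.trans_lt hB)
  have := h j hj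
  rw [Real.dist_eq, sub_zero, abs_lt]
  constructor <;> linarith

end Averages

/-! ### The dominant root and the limit of a solution divided by its powers -/

section BonacciRoot

theorem isRoot_bonacciCharPoly_iff {n : ℕ} {x : ℝ} :
    (bonacciCharPoly n).IsRoot x ↔ x ^ n = ∑ i ∈ Finset.range n, x ^ i := by
  simp [bonacciCharPoly, Polynomial.IsRoot, Polynomial.eval_finsetSum, sub_eq_zero]

/-- For positive arguments `∑ x ^ i / x ^ n` is strictly decreasing, so it takes the value 1 only
once; the proof compares cross-multiplied terms. -/
theorem le_of_pow_eq_geom_sum {n : ℕ} (hn : n ≠ 0) {x y : ℝ} (hx : 0 < x)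
    (hxn : x ^ n = ∑ i ∈ Finset.range n, x ^ i) (hyn : y ^ n = ∑ i ∈ Finset.range n, y ^ i) :
    y ≤ x := by
  by_contra! hxy
  have h : ∑ i ∈ Finset.range n, y ^ i * x ^ n < ∑ i ∈ Finset.range n, x ^ i * y ^ n := by
    refine Finset.sum_lt_sum_of_nonempty (Finset.nonempty_range_iff.2 hn) fun i hi => ?_
    rw [Finset.mem_range] at hi
    obtain ⟨l, rfl⟩ := Nat.exists_eq_add_of_lt hi
    have h1 : x ^ (l + 1) < y ^ (l + 1) := pow_lt_pow_left₀ hxy hx.le (by omega)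
    have h2 : 0 < x ^ i * y ^ i := mul_pos (pow_pos hx _) (pow_pos (hx.trans hxy) _)
    calc y ^ i * x ^ (i + l + 1) = x ^ i * y ^ i * x ^ (l + 1) := by ring
      _ < x ^ i * y ^ i * y ^ (l + 1) := by gcongr
      _ = x ^ i * y ^ (i + l + 1) := by ring
  rw [← Finset.sum_mul, ← Finset.sum_mul, ← hxn, ← hyn] at h
  linarith

theorem exists_one_lt_pow_eq_geom_sum {n : ℕ} (hn : 2 ≤ n) :
    ∃ r : ℝ, 1 < r ∧ r ^ n = ∑ i ∈ Finset.range n, r ^ i := by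
  have hcont : ContinuousOn (fun x : ℝ => x ^ n - ∑ i ∈ Finset.range n, x ^ i) (Set.Icc 1 2) := by
    fun_prop
  have h2 : (∑ i ∈ Finset.range n, (2 : ℝ) ^ i) = 2 ^ n - 1 := by
    have := geom_sum_mul (2 : ℝ) n
    linarith
  have hn' : (2 : ℝ) ≤ n := by exact_mod_cast hn
  -- The polynomial takes the value `1 - n < 0` at 1 and the value 1 at 2.
  obtain ⟨r, hr, h⟩ := intermediate_value_Icc (by norm_num) hcont
    (show (0 : ℝ) ∈ Set.Icc _ _ from ⟨by simp; linarith, by simp [h2]⟩)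
  refine ⟨r, lt_of_le_of_ne hr.1 ?_, by simpa [sub_eq_zero] using h⟩
  rintro rfl
  simp only [one_pow, Finset.sum_const, Finset.card_range, nsmul_eq_mul, mul_one] at h
  linarith

variable {n : ℕ} {r : ℝ}

theorem two_sub_mul_pow_eq_one (hrn : r ^ n = ∑ i ∈ Finset.range n, r ^ i) :
    (2 - r) * r ^ n = 1 := by
  have := geom_sum_mul r n
  rw [← hrn] at this
  linarith

theorem inv_pow_eq_two_sub (hr : 1 < r) (hrn : r ^ n = ∑ i ∈ Finset.range n, r ^ i) :
    r⁻¹ ^ n = 2 - r := by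
  have h := two_sub_mul_pow_eq_one hrn
  have : r ^ n ≠ 0 := by positivity
  rw [inv_pow]
  field_simp
  linarith

theorem sum_inv_pow_eq_one (hr : 1 < r) (hrn : r ^ n = ∑ i ∈ Finset.range n, r ^ i) :
    ∑ i ∈ Finset.range n, r⁻¹ ^ (i + 1) = 1 := by
  have h := geom_sum_mul r⁻¹ n
  rw [inv_pow_eq_two_sub hr hrn] at h
  have h0 : r ≠ 0 := by positivity
  have h1 : r - 1 ≠ 0 := by linarith
  simp only [pow_succ, ← Finset.sum_mul]
  apply mul_right_cancel₀ h1
  calc (∑ i ∈ Finset.range n, r⁻¹ ^ i) * r⁻¹ * (r - 1)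
      = -((∑ i ∈ Finset.range n, r⁻¹ ^ i) * (r⁻¹ - 1)) * (r⁻¹ * r) := by field_simp; ring
    _ = 1 * (r - 1) := by rw [h, inv_mul_cancel₀ h0]; ring

theorem sum_pow_mul_one_sub_inv_pow (hr : 1 < r) (hrn : r ^ n = ∑ i ∈ Finset.range n, r ^ i) :
    (∑ i ∈ Finset.range n, r ^ i * (1 - r⁻¹ ^ (i + 1))) * r =
      (((n : ℝ) + 1) * r - 2 * n) * r ^ n := by
  have h0 : r ≠ 0 := by positivity
  have h1 : ∀ i, r ^ i * (1 - r⁻¹ ^ (i + 1)) = r ^ i - r⁻¹ := by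
    intro i
    rw [pow_succ, mul_sub, ← mul_assoc, ← mul_pow, mul_inv_cancel₀ h0]
    simp
  simp only [h1, Finset.sum_sub_distrib, ← hrn, Finset.sum_const, Finset.card_range,
    nsmul_eq_mul, sub_mul, mul_assoc, inv_mul_cancel₀ h0]
  linear_combination ((n : ℝ)) * two_sub_mul_pow_eq_one hrn

theorem sum_pow_mul_one_sub_inv_pow_pos (hn : n ≠ 0) (hr : 1 < r) :
    0 < ∑ i ∈ Finset.range n, r ^ i * (1 - r⁻¹ ^ (i + 1)) := by
  refine Finset.sum_pos (fun i _ => ?_) (Finset.nonempty_range_iff.2 hn)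
  have : r⁻¹ ^ (i + 1) < 1 := pow_lt_one₀ (by positivity) (inv_lt_one_of_one_lt₀ hr) (by omega)
  have : 0 < r ^ i := by positivity
  exact mul_pos this (by linarith)

/-- The weights form a left eigenvector of the recurrence for the eigenvalue `r`. After the shift,
`y (k + n)` has weight `1 - (2 - r) = r - 1`; expanding it gives `y (k + i)` the weight `(r - 1) +
(1 - r⁻¹ ^ i) = r * (1 - r⁻¹ ^ (i + 1))`. -/
theorem bonacci_invariant_succ (hr : 1 < r) (hrn : r ^ n = ∑ i ∈ Finset.range n, r ^ i)
    {y : ℕ → ℝ} (hy : ∀ k, y (k + n) = ∑ i ∈ Finset.range n, y (k + i)) (k : ℕ) :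
    ∑ i ∈ Finset.range n, y (k + 1 + i) * (1 - r⁻¹ ^ (i + 1)) =
      r * ∑ i ∈ Finset.range n, y (k + i) * (1 - r⁻¹ ^ (i + 1)) := by
  have h0 : r ≠ 0 := by positivity
  have h1 := Finset.sum_range_succ' (fun i => y (k + i) * (1 - r⁻¹ ^ i)) n
  rw [Finset.sum_range_succ] at h1
  simp only [pow_zero, sub_self, mul_zero, add_zero, inv_pow_eq_two_sub hr hrn] at h1
  have h2 : ∀ i, y (k + 1 + i) = y (k + (i + 1)) := fun i => by congr 1; omega
  simp only [h2, ← h1, hy, Finset.mul_sum, Finset.sum_mul, ← Finset.sum_add_distrib]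
  refine Finset.sum_congr rfl fun i _ => ?_
  rw [pow_succ]
  field_simp
  ring

theorem bonacci_invariant (hr : 1 < r) (hrn : r ^ n = ∑ i ∈ Finset.range n, r ^ i)
    {y : ℕ → ℝ} (hy : ∀ k, y (k + n) = ∑ i ∈ Finset.range n, y (k + i)) (k : ℕ) :
    ∑ i ∈ Finset.range n, y (k + i) * (1 - r⁻¹ ^ (i + 1)) =
      r ^ k * ∑ i ∈ Finset.range n, y i * (1 - r⁻¹ ^ (i + 1)) := by
  induction k with
  | zero => simp
  | succ k ih => rw [bonacci_invariant_succ hr hrn hy, ih, pow_succ]; ring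

theorem tendsto_bonacci_div_pow (hn : n ≠ 0) (hr : 1 < r)
    (hrn : r ^ n = ∑ i ∈ Finset.range n, r ^ i)
    {y : ℕ → ℝ} (hy : ∀ k, y (k + n) = ∑ i ∈ Finset.range n, y (k + i)) :
    Tendsto (fun k => y k / r ^ k) atTop
      (nhds ((∑ i ∈ Finset.range n, y i * (1 - r⁻¹ ^ (i + 1))) /
        ∑ i ∈ Finset.range n, r ^ i * (1 - r⁻¹ ^ (i + 1)))) := by
  set E := ∑ i ∈ Finset.range n, y i * (1 - r⁻¹ ^ (i + 1)) with hE
  set K := ∑ i ∈ Finset.range n, r ^ i * (1 - r⁻¹ ^ (i + 1)) with hK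
  have hKpos : 0 < K := sum_pow_mul_one_sub_inv_pow_pos hn hr
  have h0 : r ≠ 0 := by positivity
  have hn0 : 0 < n := Nat.pos_of_ne_zero hn
  have hsum : ∑ i ∈ Finset.range n, r ^ i / r ^ n = 1 := by
    rw [← Finset.sum_div, ← hrn, div_self (by positivity)]
  rw [← tendsto_sub_nhds_zero_iff]
  -- The weights `t i` turn the invariant, divided by `r ^ k`, into the constant `E`, while their
  -- own sum is `K`; hence they annihilate `y k / r ^ k - E / K`.
  refine tendsto_zero_of_average (n := n) (a := fun i => r ^ i / r ^ n)
    (t := fun i => r ^ i * (1 - r⁻¹ ^ (i + 1))) hn0 (fun i _ => by positivity) hsum ?_ ?_ ?_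
  · intro k
    simp only [mul_sub, Finset.sum_sub_distrib, ← Finset.sum_mul, hsum, one_mul, hy,
      Finset.sum_div]
    congr 1
    refine Finset.sum_congr rfl fun i _ => ?_
    rw [pow_add, pow_add]
    field_simp
  · intro i _
    have : r⁻¹ ^ (i + 1) < 1 := pow_lt_one₀ (by positivity) (inv_lt_one_of_one_lt₀ hr) (by omega)
    have : 0 < r ^ i := by positivity
    exact mul_pos this (by linarith)
  · intro k
    have h1 : ∀ i, r ^ i * (1 - r⁻¹ ^ (i + 1)) * (y (k + i) / r ^ (k + i)) =
        y (k + i) * (1 - r⁻¹ ^ (i + 1)) * (r ^ k)⁻¹ := by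
      intro i
      rw [pow_add r k i, div_eq_mul_inv, mul_inv]
      calc _ = y (k + i) * (1 - r⁻¹ ^ (i + 1)) * (r ^ k)⁻¹ * (r ^ i * (r ^ i)⁻¹) := by ring
        _ = _ := by rw [mul_inv_cancel₀ (pow_ne_zero i h0), mul_one]
    simp only [mul_sub _ _ (E / K), Finset.sum_sub_distrib, ← Finset.sum_mul, ← hK, h1,
      bonacci_invariant hr hrn hy, ← hE]
    field_simp
    ring

end BonacciRoot

/-! ### Asymptotics of the growth function and the polynomial case -/

section Growth

theorem swapGrowth_eq_sum_paddedCount {n : ℕ} (hn : n ≠ 0) (k : ℕ) :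
    swapGrowth (n + 1) k = ∑ j ∈ Finset.range (k + n), paddedCount n j := by
  have h1 : k + n = (n - 1) + (k + 1) := by omega
  have h2 : ∑ j ∈ Finset.range (n - 1), paddedCount n j = 0 := Finset.sum_eq_zero fun i hi =>
    paddedCount_of_lt (by rw [Finset.mem_range] at hi; omega)
  rw [swapGrowth_eq (by omega), h1, Finset.sum_range_add _ (n - 1) (k + 1), h2, zero_add]
  refine Finset.sum_congr rfl fun i _ => ?_
  rw [add_comm (n - 1), paddedCount_add hn]

theorem sum_paddedCount_add {n : ℕ} (hn : n ≠ 0) (k : ℕ) :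
    ∑ j ∈ Finset.range (k + n), paddedCount n j =
      1 + ∑ i ∈ Finset.range n, ∑ j ∈ Finset.range (k + i), paddedCount n j := by
  have hzero : ∀ i < n, ∑ j ∈ Finset.range i, paddedCount n j = 0 := fun i hi =>
    Finset.sum_eq_zero fun j hj => paddedCount_of_lt (by rw [Finset.mem_range] at hj; omega)
  induction k with
  | zero =>
    obtain ⟨l, rfl⟩ := Nat.exists_eq_succ_of_ne_zero hn
    have h2 : ∑ i ∈ Finset.range (l + 1), ∑ j ∈ Finset.range (0 + i), paddedCount (l + 1) j = 0 :=
      Finset.sum_eq_zero fun i hi => by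
        rw [zero_add]
        exact hzero i (Finset.mem_range.1 hi)
    rw [h2, zero_add, Finset.sum_range_succ, hzero l (by omega)]
    simpa using paddedCount_sub_one hn
  | succ k ih =>
    have h3 : ∀ i, ∑ j ∈ Finset.range (k + 1 + i), paddedCount n j =
        ∑ j ∈ Finset.range (k + i), paddedCount n j + paddedCount n (k + i) := by
      intro i
      rw [← Finset.sum_range_succ]
      congr 2
      omega
    rw [h3, ih, paddedCount_add_self_eq_sum hn, add_assoc, ← Finset.sum_add_distrib]
    simp only [h3]

theorem tendsto_swapGrowth_div_pow {n : ℕ} (hn : 2 ≤ n) {r : ℝ} (hr : 1 < r)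
    (hrn : r ^ n = ∑ i ∈ Finset.range n, r ^ i) :
    Tendsto (fun k => (swapGrowth (n + 1) k : ℝ) / r ^ (k + n)) atTop
      (nhds (∑ i ∈ Finset.range n, r ^ i * (1 - r⁻¹ ^ (i + 1)))⁻¹) := by
  have hn0 : n ≠ 0 := by omega
  have hn1 : (n : ℝ) - 1 ≠ 0 := by
    have : (2 : ℝ) ≤ n := by exact_mod_cast hn
    linarith
  -- A constant `c` absorbs the inhomogeneous 1 exactly when `(n - 1) * c = 1`.
  set y : ℕ → ℝ := fun k =>
    ((∑ j ∈ Finset.range k, paddedCount n j : ℕ) : ℝ) + ((n : ℝ) - 1)⁻¹ with hydef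
  have hy : ∀ k, y (k + n) = ∑ i ∈ Finset.range n, y (k + i) := by
    intro k
    simp only [hydef, sum_paddedCount_add hn0, Finset.sum_add_distrib, Finset.sum_const,
      Finset.card_range, nsmul_eq_mul]
    rw [Nat.cast_add, Nat.cast_sum (Finset.range n)]
    field_simp
    push_cast
    ring
  have hy0 : ∀ i ∈ Finset.range n, y i * (1 - r⁻¹ ^ (i + 1)) =
      ((n : ℝ) - 1)⁻¹ * (1 - r⁻¹ ^ (i + 1)) := by
    intro i hi
    rw [Finset.mem_range] at hi
    simp only [hydef]
    rw [Finset.sum_eq_zero, Nat.cast_zero, zero_add]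
    intro j hj
    rw [Finset.mem_range] at hj
    exact paddedCount_of_lt (by omega)
  have hlim := tendsto_bonacci_div_pow hn0 hr hrn hy
  -- The first `n` partial sums vanish, so the invariant starts at `(n - 1)⁻¹ * (n - 1) = 1`.
  rw [Finset.sum_congr rfl hy0, ← Finset.mul_sum, Finset.sum_sub_distrib,
    sum_inv_pow_eq_one hr hrn] at hlim
  simp only [Finset.sum_const, Finset.card_range, nsmul_eq_mul, mul_one, inv_mul_cancel₀ hn1,
    one_div] at hlim
  have hconst : Tendsto (fun k : ℕ => ((n : ℝ) - 1)⁻¹ * r⁻¹ ^ k) atTop (nhds 0) := by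
    simpa using (tendsto_pow_atTop_nhds_zero_of_lt_one (r := r⁻¹) (by positivity)
      (inv_lt_one_of_one_lt₀ hr)).const_mul ((n : ℝ) - 1)⁻¹
  have hsub := (hlim.sub hconst).comp (tendsto_add_atTop_nat n)
  rw [sub_zero] at hsub
  refine hsub.congr fun k => ?_
  simp only [Function.comp_apply, hydef, swapGrowth_eq_sum_paddedCount hn0, inv_pow]
  field_simp
  ring

theorem isEquivalent_swapGrowth {n : ℕ} (hn : 2 ≤ n) {r : ℝ} (hr : 1 < r)
    (hrn : r ^ n = ∑ i ∈ Finset.range n, r ^ i) :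
    0 < ((n : ℝ) + 1) * r - 2 * n ∧ (fun k : ℕ => (swapGrowth (n + 1) k : ℝ)) ~[atTop]
      fun k : ℕ => r ^ (k + 1) / (((n : ℝ) + 1) * r - 2 * n) := by
  have hlim := tendsto_swapGrowth_div_pow hn hr hrn
  have hK := sum_pow_mul_one_sub_inv_pow hr hrn
  have hKpos := sum_pow_mul_one_sub_inv_pow_pos (n := n) (by omega) hr
  set K := ∑ i ∈ Finset.range n, r ^ i * (1 - r⁻¹ ^ (i + 1))
  set D := ((n : ℝ) + 1) * r - 2 * n
  have h0 : r ≠ 0 := by positivity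
  have hD : 0 < D := by
    -- The denominator inherits its sign from `K`, a sum of positive terms.
    have h1 : 0 < D * r ^ n := by rw [← hK]; positivity
    exact pos_of_mul_pos_left h1 (by positivity)
  refine ⟨hD, ?_⟩
  rw [isEquivalent_iff_tendsto_one (Eventually.of_forall fun k => by positivity)]
  have h2 := hlim.mul_const K
  rw [inv_mul_cancel₀ hKpos.ne'] at h2
  refine h2.congr fun k => ?_
  have h3 : K = D * r ^ n / r := by rw [← hK]; field_simp
  simp only [Pi.div_apply, h3, pow_add, pow_one]
  field_simp

theorem not_hasPolynomialGrowth_swapGrowth {n : ℕ} (hn : 2 ≤ n) :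
    ¬ HasPolynomialGrowth (swapGrowth (n + 1)) := by
  rintro ⟨d, hd⟩
  obtain ⟨r, hr, hrn⟩ := exists_one_lt_pow_eq_geom_sum hn
  obtain ⟨hD, heq⟩ := isEquivalent_swapGrowth hn hr hrn
  have h1 : (fun k : ℕ => r ^ k) =O[atTop]
      fun k : ℕ => r ^ (k + 1) / (((n : ℝ) + 1) * r - 2 * n) := by
    refine IsBigO.of_bound ((((n : ℝ) + 1) * r - 2 * n) / r) (Eventually.of_forall fun k => ?_)
    have : 0 < r := by positivity
    rw [Real.norm_of_nonneg (by positivity), Real.norm_of_nonneg (by positivity), pow_succ]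
    apply le_of_eq
    have hD' := hD.ne'
    generalize ((n : ℝ) + 1) * r - 2 * n = D at hD'
    field_simp
  have h2 := ((h1.trans heq.isBigO_symm).trans hd).trans_isLittleO
    (isLittleO_pow_const_const_pow_of_one_lt d hr)
  refine (isLittleO_irrefl (Eventually.of_forall fun k => ?_).frequently) h2
  positivity

theorem ncard_normalRepresentatives_two (k : ℕ) : (normalRepresentatives 2 k).ncard = 1 := by
  have h : ∀ j, paddedCount 1 j = 1 := by
    intro j
    induction j with
    | zero => exact paddedCount_sub_one one_ne_zero
    | succ j ih => simpa [ih] using paddedCount_add_self_eq_sum one_ne_zero j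
  rw [← h (k + 0)]
  exact (paddedCount_add one_ne_zero k).symm

theorem hasPolynomialGrowth_swapGrowth_two : HasPolynomialGrowth (swapGrowth 2) := by
  refine ⟨1, IsBigO.of_bound 2 ?_⟩
  filter_upwards [eventually_ge_atTop 1] with k hk
  have hk' : (1 : ℝ) ≤ k := by exact_mod_cast hk
  simp only [swapGrowth_eq le_rfl, ncard_normalRepresentatives_two, Finset.sum_const,
    Finset.card_range, smul_eq_mul, mul_one, pow_one, Real.norm_natCast]
  push_cast
  linarith

end Growth

theorem mainTheorem4 (m : ℕ) (hm : 2 ≤ m) :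
    Nat.card (swapGroup m) = 2 ∧
    (3 ≤ m →
      (∃ r : ℝ, 1 < r ∧
        (∀ x : ℝ, 0 < x → ((bonacciCharPoly (m - 1)).IsRoot x ↔ x = r)) ∧
        0 < (m : ℝ) * r - 2 * ((m : ℝ) - 1) ∧
        (fun k : ℕ => (swapGrowth m k : ℝ)) ~[atTop]
          fun k : ℕ => r ^ (k + 1) / ((m : ℝ) * r - 2 * ((m : ℝ) - 1))) ∧
      (∃ F : ℕ → ℤ, IsBonacci (m - 1) F ∧
        ∀ k : ℕ, (swapWordCount m k : ℤ) = F (k + (m - 2)))) ∧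
    (HasPolynomialGrowth (swapGrowth m) ↔ m = 2) := by
  obtain ⟨n, rfl⟩ : ∃ n, m = n + 1 := ⟨m - 1, by omega⟩
  have hn : n ≠ 0 := by omega
  refine ⟨card_swapGroup hm, fun h3 => ⟨?_, ?_⟩, ?_⟩
  · obtain ⟨r, hr, hrn⟩ := exists_one_lt_pow_eq_geom_sum (n := n) (by omega)
    refine ⟨r, hr, fun x hx => ?_, ?_⟩
    · rw [Nat.add_sub_cancel, isRoot_bonacciCharPoly_iff]
      constructor
      · exact fun h => (le_of_pow_eq_geom_sum hn (by positivity) hrn h).antisymm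
          (le_of_pow_eq_geom_sum hn hx h hrn)
      · rintro rfl
        exact hrn
    · simpa using isEquivalent_swapGrowth (by omega) hr hrn
  · refine ⟨_, isBonacci_paddedCount hn, fun k => ?_⟩
    rw [swapWordCount_eq hm, ← paddedCount_add hn]
    congr 2
  · constructor
    · intro h
      by_contra hne
      exact not_hasPolynomialGrowth_swapGrowth (by omega) h
    · intro h
      rw [h]
      exact hasPolynomialGrowth_swapGrowth_two
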